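/- Let $\mathcal{C}$ be a lextensive category, i.e. a category with finite limits and finite coproducts that is extensive (finite coproducts are disjoint and stable under pullback; equivalently, the canonical functor $\mathcal{C}/A\times\mathcal{C}/B\to\mathcal{C}/(A\sqcup B)$ is an equivalence for all $A,B$). Then the category $\mathrm{DLens}_{\mathcal{C}}$ of dependent lenses in $\mathcal{C}$ has finite coproducts. Here $\mathrm{DLens}_{\mathcal{C}}=\mathrm{Optic}_{\mathcal{C}/ -,\,\mathcal{C}/ -}$ is the category of dependent optics for the following data. Let $\mathrm{Span}_{\mathcal{C}}$ be the bicategory whose objects are those of $\mathcal{C}$, whose 1-cells $A\to B$ are spans $A\leftarrow M\to B$, composed by pullback, and whose 2-cells are maps of spans. Let $\mathcal{C}/ -\colon \mathrm{Span}_{\mathcal{C}}^{\mathrm{op}}\to\mathbf{CAT}$ be the pseudofunctor that sends $A$ to the slice category $\mathcal{C}/A$ and a span $f=(A\leftarrow M\to B)$ to the functor $f^*\colon \mathcal{C}/B\to\mathcal{C}/A$, $Y\mapsto M\times_B Y$, which pulls back along $M\to B$ and then composes with $M\to A$. Explicitly: * An object $(X,X')^A$ of $\mathrm{DLens}_{\mathcal{C}}$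 is an object $A$ of $\mathcal{C}$ with two objects $X,X'$ of $\mathcal{C}/A$. * Morphisms are given by the coend $$\mathrm{DLens}_{\mathcal{C}}\big((X,X')^A,(Y,Y')^B\big)=\int^{f\in\mathrm{Span}_{\mathcal{C}}(A,B)}(\mathcal{C}/A)(X,f^*Y)\times(\mathcal{C}/A)(f^*Y',X'),$$ that is, they are classes $\langle l\mid r\rangle$ of triples $(f,l,r)$ with $f\colon A\to B$ a span, $l\colon X\to f^*Y$ and $r\colon f^*Y'\to X'$, modulo the equivalence relation generated by $(g,\,m_Y\circ l,\,r)\sim(f,\,l,\,r\circ m_{Y'})$ for all maps of spans $m\colon f\Rightarrow g$, where $l\colon X\to f^*Y$, $r\colon g^*Y'\to X'$, and $m_Z\colon f^*Z\to g^*Z$ is the map induced by $m$. * Let $\theta_A\colon \mathrm{id}\Rightarrow \mathrm{id}_A^*$ and $\theta_{f,g}\colon f^*\circ g^*\Rightarrow(g\circ f)^*$ be the coherence isomorphisms of $\mathcal{C}/ -$. The identity of $(X,X')^A$ is $\langle(\theta_A)_X\mid(\theta_A^{-1})_{X'}\rangle$. For $\langle l_1\mid r_1\rangle\colon (X,X')^A\to(Y,Y')^B$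 with representative $f$ and $\langle l_2\mid r_2\rangle\colon (Y,Y')^B\to(Z,Z')^D$ with representative $g$, the composite is $$\langle l_2\mid r_2\rangle\circ\langle l_1\mid r_1\rangle=\langle(\theta_{f,g})_Z\circ f^*(l_2)\circ l_1\mid r_1\circ f^*(r_2)\circ(\theta_{f,g}^{-1})_{Z'}\rangle.$$ -/

import Mathlib

open CategoryTheory Limits Bicategory Opposite

universe w v u v₁ u₁ v₂ u₂

namespace DependentOptics

noncomputable section

section Spans

variable {C : Type u} [Category.{v} C]

/-- Spans `A ⟵ M ⟶ B` in `C`; the morphisms `S ⟶ T` of this category are the maps of apices that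
commute with both legs. -/
abbrev Spn (A B : C) := Span (⊤ : MorphismProperty C) (⊤ : MorphismProperty C) A B

namespace Spn

variable {A B D E F : C}

/-- The identity span `A ⟵ A ⟶ A`. -/
def one (A : C) : Spn A A := Span.id A

/-- `A` is the apex of the identity span on `A`. -/
def toOne (A : C) : A ⟶ (one A).apex := 𝟙 A

@[simp] lemma one_r (A : C) : (one A).r = (one A).l := rfl
@[simp]
lemma toOne_l (A : C) : toOne A ≫ (one A).l = 𝟙 A := Category.id_comp _

@[simp]
lemma toOne_l_assoc {Z : C} (k : A ⟶ Z) : toOne A ≫ (one A).l ≫ k = k := by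
  rw [← Category.assoc, toOne_l, Category.id_comp]

@[simp]
lemma l_toOne (A : C) : (one A).l ≫ toOne A = 𝟙 (one A).apex := Category.id_comp _

@[simp]
lemma l_toOne_assoc {Z : C} (k : (one A).apex ⟶ Z) : (one A).l ≫ toOne A ≫ k = k := by
  rw [← Category.assoc, l_toOne, Category.id_comp]

lemma one_ext {W : C} {f g : W ⟶ (one A).apex} (h : f ≫ (one A).l = g ≫ (one A).l) : f = g := by
  simpa using congrArg (· ≫ toOne A) h

variable [HasPullbacks C]

/-- Composition of spans by pullback, `A ⟵ M ×_B N ⟶ D`. -/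
def comp (S : Spn A B) (T : Spn B D) : Spn A D := Span.comp S T

section comp

variable (S : Spn A B) (T : Spn B D)

/-- First projection of the pullback `S.apex ×_B T.apex`. -/
def fst : (comp S T).apex ⟶ S.apex := pullback.fst S.r T.l

/-- Second projection of the pullback `S.apex ×_B T.apex`. -/
def snd : (comp S T).apex ⟶ T.apex := pullback.snd S.r T.l

@[simp]
lemma snd_l : snd S T ≫ T.l = fst S T ≫ S.r := pullback.condition.symm

@[simp]
lemma snd_l_assoc {Z : C} (k : B ⟶ Z) : snd S T ≫ T.l ≫ k = fst S T ≫ S.r ≫ k := by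
  rw [← Category.assoc, snd_l, Category.assoc]

@[simp] lemma comp_l : (comp S T).l = fst S T ≫ S.l := rfl
@[simp] lemma comp_r : (comp S T).r = snd S T ≫ T.r := rfl

variable {S T}

/-- The map into the pullback `S.apex ×_B T.apex` with given components. -/
def lift {W : C} (a : W ⟶ S.apex) (b : W ⟶ T.apex) (h : a ≫ S.r = b ≫ T.l) :
    W ⟶ (comp S T).apex := pullback.lift a b h

@[simp]
lemma lift_fst {W : C} (a : W ⟶ S.apex) (b : W ⟶ T.apex) (h : a ≫ S.r = b ≫ T.l) :
    lift a b h ≫ fst S T = a := pullback.lift_fst a b h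

@[simp]
lemma lift_fst_assoc {W Z : C} (a : W ⟶ S.apex) (b : W ⟶ T.apex) (h : a ≫ S.r = b ≫ T.l)
    (k : S.apex ⟶ Z) : lift a b h ≫ fst S T ≫ k = a ≫ k := by
  rw [← Category.assoc, lift_fst]

@[simp]
lemma lift_snd {W : C} (a : W ⟶ S.apex) (b : W ⟶ T.apex) (h : a ≫ S.r = b ≫ T.l) :
    lift a b h ≫ snd S T = b := pullback.lift_snd a b h

@[simp]
lemma lift_snd_assoc {W Z : C} (a : W ⟶ S.apex) (b : W ⟶ T.apex) (h : a ≫ S.r = b ≫ T.l)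
    (k : T.apex ⟶ Z) : lift a b h ≫ snd S T ≫ k = b ≫ k := by
  rw [← Category.assoc, lift_snd]

lemma comp_ext {W : C} {f g : W ⟶ (comp S T).apex}
    (h₁ : f ≫ fst S T = g ≫ fst S T) (h₂ : f ≫ snd S T = g ≫ snd S T) : f = g :=
  pullback.hom_ext h₁ h₂

end comp

/-- The canonical isomorphism `(M ×_B N) ×_D P ≅ M ×_B (N ×_D P)`. -/
def assoc (S : Spn A B) (T : Spn B D) (U : Spn D E) : comp (comp S T) U ≅ comp S (comp T U) :=
  Span.mkIso
    { hom := lift (fst (comp S T) U ≫ fst S T)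
        (lift (fst (comp S T) U ≫ snd S T) (snd (comp S T) U) (by simp)) (by simp)
      inv := lift (lift (fst S (comp T U)) (snd S (comp T U) ≫ fst T U)
        (by simp [← snd_l S (comp T U)])) (snd S (comp T U) ≫ snd T U) (by simp)
      hom_inv_id := by
        apply comp_ext
        · apply comp_ext <;> simp
        · simp
      inv_hom_id := by
        apply comp_ext
        · simp
        · apply comp_ext <;> simp }
    (by simp) (by simp)

/-- The map `M ×_B N ⟶ M ×_B N'` induced by a map of spans `N ⟶ N'`. -/
def whiskerL (S : Spn A B) {T U : Spn B D} (η : T ⟶ U) : comp S T ⟶ comp S U :=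
  Span.Hom.mk (lift (fst S T) (snd S T ≫ Span.Hom.hom η) (by simp)) (by simp) (by simp)

/-- The map `M ×_B N ⟶ M' ×_B N` induced by a map of spans `M ⟶ M'`. -/
def whiskerR {S T : Spn A B} (η : S ⟶ T) (U : Spn B D) : comp S U ⟶ comp T U :=
  Span.Hom.mk (lift (fst S U ≫ Span.Hom.hom η) (snd S U) (by simp)) (by simp) (by simp)

/-- The canonical isomorphism `A ×_A M ≅ M`. -/
def lunit (S : Spn A B) : comp (one A) S ≅ S :=
  Span.mkIso
    { hom := snd (one A) S
      inv := lift (S.l ≫ toOne A) (𝟙 S.apex) (by simp)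
      hom_inv_id := comp_ext (one_ext (by simp)) (by simp)
      inv_hom_id := by simp } (by simp) (by simp)

/-- The canonical isomorphism `M ×_B B ≅ M`. -/
def runit (S : Spn A B) : comp S (one B) ≅ S :=
  Span.mkIso
    { hom := fst S (one B)
      inv := lift (𝟙 S.apex) (S.r ≫ toOne B) (by simp)
      hom_inv_id := comp_ext (by simp) (one_ext (by simp))
      inv_hom_id := by simp } (by simp) (by simp)

section simps

variable (S : Spn A B) (T : Spn B D) (U : Spn D E)

@[simp] lemma assoc_hom_hom : (assoc S T U).hom.hom = lift (fst (comp S T) U ≫ fst S T)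
    (lift (fst (comp S T) U ≫ snd S T) (snd (comp S T) U) (by simp)) (by simp) := rfl

@[simp] lemma assoc_inv_hom : (assoc S T U).inv.hom =
    lift (lift (fst S (comp T U)) (snd S (comp T U) ≫ fst T U) (by simp [← snd_l S (comp T U)]))
      (snd S (comp T U) ≫ snd T U) (by simp) := rfl

@[simp] lemma lunit_hom_hom : (lunit S).hom.hom = snd (one A) S := rfl

@[simp] lemma lunit_inv_hom :
    (lunit S).inv.hom = lift (S.l ≫ toOne A) (𝟙 S.apex) (by simp) := rfl

@[simp] lemma runit_hom_hom : (runit S).hom.hom = fst S (one B) := rfl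

@[simp] lemma runit_inv_hom :
    (runit S).inv.hom = lift (𝟙 S.apex) (S.r ≫ toOne B) (by simp) := rfl

@[simp] lemma whiskerL_hom {T T' : Spn B D} (η : T ⟶ T') : (whiskerL S η).hom =
    lift (fst S T) (snd S T ≫ Span.Hom.hom η) (by simp) := rfl

@[simp] lemma whiskerR_hom {S S' : Spn A B} (η : S ⟶ S') (T : Spn B D) : (whiskerR η T).hom =
    lift (fst S T ≫ Span.Hom.hom η) (snd S T) (by simp) := rfl

end simps

lemma whiskerL_id (S : Spn A B) (T : Spn B D) : whiskerL S (𝟙 T) = 𝟙 (comp S T) := by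
  apply Span.hom_ext; apply comp_ext <;> simp

lemma whiskerL_comp (S : Spn A B) {T U V : Spn B D} (η : T ⟶ U) (θ : U ⟶ V) :
    whiskerL S (η ≫ θ) = whiskerL S η ≫ whiskerL S θ := by
  apply Span.hom_ext; apply comp_ext <;> simp

lemma id_whiskerL {S T : Spn A B} (η : S ⟶ T) :
    whiskerL (one A) η = (lunit S).hom ≫ η ≫ (lunit T).inv := by
  apply Span.hom_ext; apply comp_ext
  · apply one_ext; simp
  · simp

lemma comp_whiskerL (S : Spn A B) (T : Spn B D) {U V : Spn D E} (η : U ⟶ V) :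
    whiskerL (comp S T) η =
      (assoc S T U).hom ≫ whiskerL S (whiskerL T η) ≫ (assoc S T V).inv := by
  apply Span.hom_ext
  apply comp_ext
  · apply comp_ext <;> simp
  · simp

lemma id_whiskerR (S : Spn A B) (T : Spn B D) : whiskerR (𝟙 S) T = 𝟙 (comp S T) := by
  apply Span.hom_ext; apply comp_ext <;> simp

lemma comp_whiskerR {S T U : Spn A B} (η : S ⟶ T) (θ : T ⟶ U) (V : Spn B D) :
    whiskerR (η ≫ θ) V = whiskerR η V ≫ whiskerR θ V := by
  apply Span.hom_ext; apply comp_ext <;> simp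

lemma whiskerR_id {S T : Spn A B} (η : S ⟶ T) :
    whiskerR η (one B) = (runit S).hom ≫ η ≫ (runit T).inv := by
  apply Span.hom_ext; apply comp_ext
  · simp
  · apply one_ext; simp

lemma whiskerR_comp {S T : Spn A B} (η : S ⟶ T) (U : Spn B D) (V : Spn D E) :
    whiskerR η (comp U V) =
      (assoc S U V).inv ≫ whiskerR (whiskerR η U) V ≫ (assoc T U V).hom := by
  apply Span.hom_ext
  apply comp_ext
  · simp
  · apply comp_ext <;> simp

lemma whisker_assoc (S : Spn A B) {T U : Spn B D} (η : T ⟶ U) (V : Spn D E) :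
    whiskerR (whiskerL S η) V =
      (assoc S T V).hom ≫ whiskerL S (whiskerR η V) ≫ (assoc S U V).inv := by
  apply Span.hom_ext
  apply comp_ext
  · apply comp_ext <;> simp
  · simp

lemma whisker_exchange {S T : Spn A B} {U V : Spn B D} (η : S ⟶ T) (θ : U ⟶ V) :
    whiskerL S θ ≫ whiskerR η V = whiskerR η U ≫ whiskerL T θ := by
  apply Span.hom_ext; apply comp_ext <;> simp

lemma pentagon (S : Spn A B) (T : Spn B D) (U : Spn D E) (V : Spn E F) :
    whiskerR (assoc S T U).hom V ≫ (assoc S (comp T U) V).hom ≫ whiskerL S (assoc T U V).hom =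
      (assoc (comp S T) U V).hom ≫ (assoc S T (comp U V)).hom := by
  apply Span.hom_ext
  apply comp_ext
  · simp
  · apply comp_ext
    · simp
    · apply comp_ext <;> simp

lemma triangle (S : Spn A B) (T : Spn B D) :
    (assoc S (one B) T).hom ≫ whiskerL S (lunit T).hom = whiskerR (runit S).hom T := by
  apply Span.hom_ext
  apply comp_ext <;> simp

end Spn

/-- The bicategory `Span_C`: objects are those of `C`, 1-cells are spans composed by pullback,
2-cells are maps of spans. -/
structure SpanBicat (C : Type u) where
  /-- the underlying object of `C` -/
  obj : C

instance SpanBicat.bicategory [HasPullbacks C] : Bicategory (SpanBicat C) where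
  Hom A B := Spn A.obj B.obj
  id A := Spn.one A.obj
  comp S T := Spn.comp S T
  homCategory A B := inferInstanceAs (Category (Spn A.obj B.obj))
  whiskerLeft S _ _ η := Spn.whiskerL S η
  whiskerRight η U := Spn.whiskerR η U
  associator := Spn.assoc
  leftUnitor := Spn.lunit
  rightUnitor := Spn.runit
  whiskerLeft_id := Spn.whiskerL_id
  whiskerLeft_comp := Spn.whiskerL_comp
  id_whiskerLeft := Spn.id_whiskerL
  comp_whiskerLeft := Spn.comp_whiskerL
  id_whiskerRight := Spn.id_whiskerR
  comp_whiskerRight := Spn.comp_whiskerR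
  whiskerRight_id := Spn.whiskerR_id
  whiskerRight_comp := Spn.whiskerR_comp
  whisker_assoc S _ _ η V := Spn.whisker_assoc S η V
  whisker_exchange := Spn.whisker_exchange
  pentagon := Spn.pentagon
  triangle := Spn.triangle

end Spans

section Slices

namespace Spn

variable {C : Type u} [Category.{v} C] [HasPullbacks C] {A B D E : C}

/-- The functor `C/B ⥤ C/A` induced by a span `A ⟵ M ⟶ B`: pull back along the right leg `M ⟶ B`,
then push forward along the left leg `M ⟶ A`. -/
def slice (S : Spn A B) : Over B ⥤ Over A := Over.pullback S.r ⋙ Over.map S.l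

section slice

variable (S : Spn A B) (Y : Over B)

/-- The projection `M ×_B Y ⟶ Y`. -/
def toFib : ((slice S).obj Y).left ⟶ Y.left := pullback.fst Y.hom S.r

/-- The projection `M ×_B Y ⟶ M`. -/
def toRep : ((slice S).obj Y).left ⟶ S.apex := pullback.snd Y.hom S.r

@[simp]
lemma toFib_hom : toFib S Y ≫ Y.hom = toRep S Y ≫ S.r := pullback.condition

@[simp]
lemma toFib_hom_assoc {Z : C} (k : B ⟶ Z) :
    toFib S Y ≫ Y.hom ≫ k = toRep S Y ≫ S.r ≫ k := by
  rw [← Category.assoc, toFib_hom, Category.assoc]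

@[simp] lemma slice_hom : ((slice S).obj Y).hom = toRep S Y ≫ S.l := rfl

variable {S Y}

/-- The map into `M ×_B Y` with given components. -/
def sliceLift {W : C} (a : W ⟶ Y.left) (b : W ⟶ S.apex) (h : a ≫ Y.hom = b ≫ S.r) :
    W ⟶ ((slice S).obj Y).left := pullback.lift a b h

@[simp]
lemma sliceLift_toFib {W : C} (a : W ⟶ Y.left) (b : W ⟶ S.apex) (h : a ≫ Y.hom = b ≫ S.r) :
    sliceLift a b h ≫ toFib S Y = a := pullback.lift_fst a b h

@[simp]
lemma sliceLift_toFib_assoc {W Z : C} (a : W ⟶ Y.left) (b : W ⟶ S.apex)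
    (h : a ≫ Y.hom = b ≫ S.r) (k : Y.left ⟶ Z) : sliceLift a b h ≫ toFib S Y ≫ k = a ≫ k := by
  rw [← Category.assoc, sliceLift_toFib]

@[simp]
lemma sliceLift_toRep {W : C} (a : W ⟶ Y.left) (b : W ⟶ S.apex) (h : a ≫ Y.hom = b ≫ S.r) :
    sliceLift a b h ≫ toRep S Y = b := pullback.lift_snd a b h

@[simp]
lemma sliceLift_toRep_assoc {W Z : C} (a : W ⟶ Y.left) (b : W ⟶ S.apex)
    (h : a ≫ Y.hom = b ≫ S.r) (k : S.apex ⟶ Z) : sliceLift a b h ≫ toRep S Y ≫ k = b ≫ k := by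
  rw [← Category.assoc, sliceLift_toRep]

lemma slice_ext {W : C} {f g : W ⟶ ((slice S).obj Y).left}
    (h₁ : f ≫ toFib S Y = g ≫ toFib S Y) (h₂ : f ≫ toRep S Y = g ≫ toRep S Y) : f = g :=
  pullback.hom_ext h₁ h₂

variable (S)

@[simp]
lemma slice_map_toFib {Z : Over B} (k : Y ⟶ Z) :
    ((slice S).map k).left ≫ toFib S Z = toFib S Y ≫ k.left := pullback.lift_fst _ _ _

@[simp]
lemma slice_map_toFib_assoc {Z : Over B} {W : C} (k : Y ⟶ Z) (j : Z.left ⟶ W) :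
    ((slice S).map k).left ≫ toFib S Z ≫ j = toFib S Y ≫ k.left ≫ j := by
  rw [← Category.assoc, slice_map_toFib, Category.assoc]

@[simp]
lemma slice_map_toRep {Z : Over B} (k : Y ⟶ Z) :
    ((slice S).map k).left ≫ toRep S Z = toRep S Y := pullback.lift_snd _ _ _

@[simp]
lemma slice_map_toRep_assoc {Z : Over B} {W : C} (k : Y ⟶ Z) (j : S.apex ⟶ W) :
    ((slice S).map k).left ≫ toRep S Z ≫ j = toRep S Y ≫ j := by
  rw [← Category.assoc, slice_map_toRep]

end slice

/-- The map `M ×_B Y ⟶ M' ×_B Y` induced by a map of spans `M ⟶ M'`. -/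
def slice₂App {S T : Spn A B} (η : S ⟶ T) (Y : Over B) : (slice S).obj Y ⟶ (slice T).obj Y :=
  Over.homMk (sliceLift (toFib S Y) (toRep S Y ≫ Span.Hom.hom η) (by simp)) (by simp)

@[simp] lemma slice₂App_left {S T : Spn A B} (η : S ⟶ T) (Y : Over B) : (slice₂App η Y).left =
    sliceLift (toFib S Y) (toRep S Y ≫ Span.Hom.hom η) (by simp) := rfl

/-- The natural transformation between slice functors induced by a map of spans. -/
def slice₂ {S T : Spn A B} (η : S ⟶ T) : slice S ⟶ slice T where
  app Y := slice₂App η Y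
  naturality Y Z k := by
    ext
    apply slice_ext <;> simp

/-- The canonical isomorphism `A ×_A Y ≅ Y`. -/
def sliceOneApp (Y : Over A) : (slice (one A)).obj Y ≅ Y :=
  Over.isoMk
    { hom := toFib (one A) Y
      inv := sliceLift (𝟙 Y.left) (Y.hom ≫ toOne A) (by simp)
      hom_inv_id := slice_ext (by simp) (one_ext (by simp))
      inv_hom_id := by simp } (by simp)

@[simp] lemma sliceOneApp_hom_left (Y : Over A) :
    (sliceOneApp Y).hom.left = toFib (one A) Y := rfl

/-- Slicing along the identity span is isomorphic to the identity functor. -/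
def sliceOne (A : C) : slice (one A) ≅ 𝟭 (Over A) :=
  NatIso.ofComponents sliceOneApp (by
    intro Y Z k
    ext
    simp)

/-- The canonical isomorphism `(M ×_B N) ×_D Y ≅ M ×_B (N ×_D Y)`. -/
def sliceCompApp (S : Spn A B) (T : Spn B D) (Y : Over D) :
    (slice (comp S T)).obj Y ≅ (slice S).obj ((slice T).obj Y) :=
  Over.isoMk
    { hom := sliceLift (Y := (slice T).obj Y)
        (sliceLift (toFib (comp S T) Y) (toRep (comp S T) Y ≫ snd S T) (by simp))
        (toRep (comp S T) Y ≫ fst S T) (by simp)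
      inv := sliceLift (toFib S ((slice T).obj Y) ≫ toFib T Y)
        (lift (toRep S ((slice T).obj Y)) (toFib S ((slice T).obj Y) ≫ toRep T Y)
          (by simp [← toFib_hom S ((slice T).obj Y)])) (by simp)
      hom_inv_id := by
        apply slice_ext
        · simp
        · apply comp_ext <;> simp
      inv_hom_id := by
        apply slice_ext
        · apply slice_ext <;> simp
        · simp } (by simp)

@[simp] lemma sliceCompApp_hom_left (S : Spn A B) (T : Spn B D) (Y : Over D) :
    (sliceCompApp S T Y).hom.left = sliceLift (Y := (slice T).obj Y)
        (sliceLift (toFib (comp S T) Y) (toRep (comp S T) Y ≫ snd S T) (by simp))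
        (toRep (comp S T) Y ≫ fst S T) (by simp) := rfl

/-- Slicing along a composite span is isomorphic to slicing in two steps. -/
def sliceComp (S : Spn A B) (T : Spn B D) : slice (comp S T) ≅ slice T ⋙ slice S :=
  NatIso.ofComponents (sliceCompApp S T) (by
    intro Y Z k
    ext
    apply slice_ext (Y := (slice T).obj Z)
    · apply slice_ext <;> simp
    · simp)

section simps

variable (S : Spn A B) (T : Spn B D)

@[simp] lemma slice₂_app_left {S S' : Spn A B} (η : S ⟶ S') (Y : Over B) :
    ((slice₂ η).app Y).left =
      sliceLift (toFib S Y) (toRep S Y ≫ Span.Hom.hom η) (by simp) := rfl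

@[simp] lemma sliceOne_hom_app_left (Y : Over A) :
    ((sliceOne A).hom.app Y).left = toFib (one A) Y := rfl

@[simp] lemma sliceOne_inv_app_left (Y : Over A) :
    ((sliceOne A).inv.app Y).left = sliceLift (𝟙 Y.left) (Y.hom ≫ toOne A) (by simp) := rfl

@[simp] lemma sliceComp_hom_app_left (Y : Over D) :
    ((sliceComp S T).hom.app Y).left = sliceLift (Y := (slice T).obj Y)
        (sliceLift (toFib (comp S T) Y) (toRep (comp S T) Y ≫ snd S T) (by simp))
        (toRep (comp S T) Y ≫ fst S T) (by simp) := rfl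

@[simp] lemma sliceComp_inv_app_left (Y : Over D) :
    ((sliceComp S T).inv.app Y).left = sliceLift (toFib S ((slice T).obj Y) ≫ toFib T Y)
        (lift (toRep S ((slice T).obj Y)) (toFib S ((slice T).obj Y) ≫ toRep T Y)
          (by simp [← toFib_hom S ((slice T).obj Y)])) (by simp) := rfl

end simps

lemma slice₂_id (S : Spn A B) : slice₂ (𝟙 S) = 𝟙 (slice S) := by
  ext Y
  apply slice_ext <;> simp

lemma slice₂_comp {S T U : Spn A B} (η : S ⟶ T) (θ : T ⟶ U) :
    slice₂ (η ≫ θ) = slice₂ η ≫ slice₂ θ := by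
  ext Y
  apply slice_ext <;> simp

lemma slice₂_whiskerL (S : Spn A B) {T U : Spn B D} (η : T ⟶ U) :
    slice₂ (whiskerL S η) = (sliceComp S T).hom ≫
      Functor.whiskerRight (slice₂ η) (slice S) ≫ (sliceComp S U).inv := by
  ext Y
  apply slice_ext
  · simp
  · apply comp_ext <;> simp

lemma slice₂_whiskerR {S T : Spn A B} (η : S ⟶ T) (U : Spn B D) :
    slice₂ (whiskerR η U) = (sliceComp S U).hom ≫
      Functor.whiskerLeft (slice U) (slice₂ η) ≫ (sliceComp T U).inv := by
  ext Y
  apply slice_ext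
  · simp
  · apply comp_ext <;> simp

lemma slice₂_assoc_inv (S : Spn A B) (T : Spn B D) (U : Spn D E) :
    slice₂ (assoc S T U).inv = (sliceComp S (comp T U)).hom ≫
      Functor.whiskerRight (sliceComp T U).hom (slice S) ≫
      (Functor.associator (slice U) (slice T) (slice S)).hom ≫
      Functor.whiskerLeft (slice U) (sliceComp S T).inv ≫ (sliceComp (comp S T) U).inv := by
  ext Y
  apply slice_ext
  · simp
  · apply comp_ext
    · apply comp_ext <;> simp
    · simp

lemma slice₂_runit (S : Spn A B) :
    slice₂ (runit S).hom = (sliceComp S (one B)).hom ≫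
      Functor.whiskerRight (sliceOne B).hom (slice S) ≫ (Functor.leftUnitor (slice S)).hom := by
  ext Y
  apply slice_ext <;> simp

lemma slice₂_lunit (S : Spn A B) :
    slice₂ (lunit S).hom = (sliceComp (one A) S).hom ≫
      Functor.whiskerLeft (slice S) (sliceOne A).hom ≫ (Functor.rightUnitor (slice S)).hom := by
  ext Y
  apply slice_ext <;> simp

end Spn

variable (C : Type u) [Category.{v} C] [HasPullbacks C]

/-- The `Span_C`-indexed category of slices. -/
def slicePseudofunctor : (SpanBicat C)ᵒᵖ ⥤ᵖ Cat.{v, max u v} where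
  obj A := Cat.of (Over A.unop.obj)
  map S := (Spn.slice S.unop).toCatHom
  map₂ η := (Spn.slice₂ η.unop2).toCatHom₂
  map₂_id S := congrArg NatTrans.toCatHom₂ (Spn.slice₂_id S.unop)
  map₂_comp η θ := congrArg NatTrans.toCatHom₂ (Spn.slice₂_comp η.unop2 θ.unop2)
  mapId A := Cat.Hom.isoMk (Spn.sliceOne A.unop.obj)
  mapComp S T := Cat.Hom.isoMk (Spn.sliceComp T.unop S.unop)
  map₂_whisker_left S _ _ η := congrArg NatTrans.toCatHom₂ (Spn.slice₂_whiskerR η.unop2 S.unop)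
  map₂_whisker_right η T := congrArg NatTrans.toCatHom₂ (Spn.slice₂_whiskerL T.unop η.unop2)
  map₂_associator S T U :=
    congrArg NatTrans.toCatHom₂ (Spn.slice₂_assoc_inv U.unop T.unop S.unop)
  map₂_left_unitor S := congrArg NatTrans.toCatHom₂ (Spn.slice₂_runit S.unop)
  map₂_right_unitor S := congrArg NatTrans.toCatHom₂ (Spn.slice₂_lunit S.unop)

end Slices

section IndexedCategories

variable {B : Type u} [Bicategory.{w, v} B]

/-- A `B`-indexed category: a pseudofunctor `Bᵒᵖ ⥤ Cat`, where `Bᵒᵖ` reverses 1-cells only. -/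
abbrev IndexedCat (B : Type u) [Bicategory.{w, v} B] := Bᵒᵖ ⥤ᵖ Cat.{v₁, u₁}

namespace IndexedCat

variable (L : IndexedCat.{w, v, u, v₁, u₁} B) {A D E F : B}

/-- The fibre `L^A`. -/
abbrev Fib (A : B) : Type u₁ := L.obj (op A)

/-- The functor `f^* : L^{D} ⥤ L^A`. -/
def pull (f : A ⟶ D) : L.Fib D ⥤ L.Fib A := (L.map f.op).toFunctor

/-- The natural transformation `f^* ⟶ g^*` given by a 2-cell `f ⟶ g`. -/
def pull₂ {f g : A ⟶ D} (m : f ⟶ g) : L.pull f ⟶ L.pull g :=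
  (L.map₂ (Bicategory.Opposite.op2 m)).toNatTrans

/-- The unit coherence isomorphism `(id_A)^* ≅ id`. -/
def pullId (A : B) : L.pull (𝟙 A) ≅ 𝟭 (L.Fib A) :=
  Cat.Hom.toNatIso (L.mapId (op A))

/-- The composition coherence isomorphism `(g ∘ f)^* ≅ f^* ∘ g^*`. -/
def pullComp (f : A ⟶ D) (g : D ⟶ E) : L.pull (f ≫ g) ≅ L.pull g ⋙ L.pull f :=
  Cat.Hom.toNatIso (L.mapComp g.op f.op)

variable {L}

lemma pull₂_whiskerLeft (f : A ⟶ D) {g h : D ⟶ E} (m : g ⟶ h) (Y : L.Fib E) :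
    (L.pull₂ (f ◁ m)).app Y = (L.pullComp f g).hom.app Y ≫
      (L.pull f).map ((L.pull₂ m).app Y) ≫ (L.pullComp f h).inv.app Y :=
  congrArg (fun t => t.toNatTrans.app Y)
    (L.map₂_whisker_right (Bicategory.Opposite.op2 m) f.op)

lemma pull₂_whiskerRight {f g : A ⟶ D} (m : f ⟶ g) (h : D ⟶ E) (Y : L.Fib E) :
    (L.pull₂ (m ▷ h)).app Y = (L.pullComp f h).hom.app Y ≫
      (L.pull₂ m).app ((L.pull h).obj Y) ≫ (L.pullComp g h).inv.app Y :=
  congrArg (fun t => t.toNatTrans.app Y)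
    (L.map₂_whisker_left h.op (Bicategory.Opposite.op2 m))

lemma pull₂_assoc_inv (f : A ⟶ D) (g : D ⟶ E) (h : E ⟶ F) (Y : L.Fib F) :
    (L.pull₂ (α_ f g h).inv).app Y = (L.pullComp f (g ≫ h)).hom.app Y ≫
      (L.pull f).map ((L.pullComp g h).hom.app Y) ≫
      (L.pullComp f g).inv.app ((L.pull h).obj Y) ≫ (L.pullComp (f ≫ g) h).inv.app Y := by
  refine (congrArg (fun t => t.toNatTrans.app Y) (L.map₂_associator h.op g.op f.op)).trans ?_
  exact congrArg (fun t => (L.pullComp f (g ≫ h)).hom.app Y ≫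
    (L.pull f).map ((L.pullComp g h).hom.app Y) ≫ t) (Category.id_comp _)

lemma pull₂_leftUnitor (f : A ⟶ D) (Y : L.Fib D) :
    (L.pull₂ (λ_ f).hom).app Y =
      (L.pullComp (𝟙 A) f).hom.app Y ≫ (L.pullId A).hom.app ((L.pull f).obj Y) := by
  refine (congrArg (fun t => t.toNatTrans.app Y) (L.map₂_right_unitor f.op)).trans ?_
  exact congrArg (fun t => (L.pullComp (𝟙 A) f).hom.app Y ≫ t) (Category.comp_id _)

lemma pull₂_rightUnitor (f : A ⟶ D) (Y : L.Fib D) :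
    (L.pull₂ (ρ_ f).hom).app Y =
      (L.pullComp f (𝟙 D)).hom.app Y ≫ (L.pull f).map ((L.pullId D).hom.app Y) := by
  refine (congrArg (fun t => t.toNatTrans.app Y) (L.map₂_left_unitor f.op)).trans ?_
  exact congrArg (fun t => (L.pullComp f (𝟙 D)).hom.app Y ≫ t) (Category.comp_id _)

end IndexedCat

end IndexedCategories

section Optics

variable {B : Type u} [Bicategory.{w, v} B]

/-- Objects `(X, X')^A` of the category of dependent optics. -/
structure Optic (L : IndexedCat.{w, v, u, v₁, u₁} B) (R : IndexedCat.{w, v, u, v₂, u₂} B) where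
  /-- the base object `A` -/
  base : B
  /-- the forward object `X` of `L^A` -/
  fwd : L.Fib base
  /-- the backward object `X'` of `R^A` -/
  bwd : R.Fib base

namespace Optic

variable {L : IndexedCat.{w, v, u, v₁, u₁} B} {R : IndexedCat.{w, v, u, v₂, u₂} B}

/-- A representative `(l, r)` of an optic: a 1-cell `f : A ⟶ B` with `l : X ⟶ f^* Y` in `L^A` and
`r : f^* Y' ⟶ X'` in `R^A`. -/
structure PreHom (P Q : Optic L R) where
  /-- the representative `f` -/
  rep : P.base ⟶ Q.base
  /-- the forward part -/
  get : P.fwd ⟶ (L.pull rep).obj Q.fwd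
  /-- the backward part -/
  put : (R.pull rep).obj Q.bwd ⟶ P.bwd

/-- The relation generating the coend
`∫^f L^A(X, f^* Y) × R^A(f^* Y', X')`: for every 2-cell `m : f ⟶ g`,
`(L(m)_Y ∘ l, r) ∼ (l, r ∘ R(m)_{Y'})`. -/
inductive Rel (P Q : Optic L R) : PreHom P Q → PreHom P Q → Prop
  | slide {f g : P.base ⟶ Q.base} (m : f ⟶ g) (l : P.fwd ⟶ (L.pull f).obj Q.fwd)
      (r : (R.pull g).obj Q.bwd ⟶ P.bwd) :
      Rel P Q ⟨g, l ≫ (L.pull₂ m).app Q.fwd, r⟩ ⟨f, l, (R.pull₂ m).app Q.bwd ≫ r⟩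

/-- Morphisms of optics: the coend, i.e. representatives modulo the equivalence relation generated
by `Rel`. -/
def Hom (P Q : Optic L R) := Quot (Rel P Q)

/-- The optic with given representative. -/
def ofRep {P Q : Optic L R} (p : PreHom P Q) : Hom P Q := Quot.mk _ p

lemma ofRep_eq {P Q : Optic L R} {p q : PreHom P Q} (m : p.rep ⟶ q.rep)
    (h₁ : p.get ≫ (L.pull₂ m).app Q.fwd = q.get) (h₂ : p.put = (R.pull₂ m).app Q.bwd ≫ q.put) :
    ofRep p = ofRep q := by
  obtain ⟨f, l, r⟩ := p
  obtain ⟨g, l', r'⟩ := q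
  dsimp only at m h₁ h₂
  subst h₁ h₂
  exact (Quot.sound (Rel.slide m l r')).symm

/-- The representative of the identity optic. -/
def preId (P : Optic L R) : PreHom P P where
  rep := 𝟙 P.base
  get := (L.pullId P.base).inv.app P.fwd
  put := (R.pullId P.base).hom.app P.bwd

/-- Composition of representatives:
`⟨l₂ | r₂⟩ ∘ ⟨l₁ | r₁⟩ = ⟨θ ∘ f^*(l₂) ∘ l₁ | r₁ ∘ f^*(r₂) ∘ θ'⁻¹⟩`. -/
def preComp {P Q S : Optic L R} (p : PreHom P Q) (q : PreHom Q S) : PreHom P S where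
  rep := p.rep ≫ q.rep
  get := p.get ≫ (L.pull p.rep).map q.get ≫ (L.pullComp p.rep q.rep).inv.app S.fwd
  put := (R.pullComp p.rep q.rep).hom.app S.bwd ≫ (R.pull p.rep).map q.put ≫ p.put

/-- Composition of optics. -/
def comp {P Q S : Optic L R} : Hom P Q → Hom Q S → Hom P S :=
  Quot.lift (fun p => Quot.lift (fun q => ofRep (preComp p q)) (by
      rintro _ _ ⟨m, l, r⟩
      refine (ofRep_eq (p.rep ◁ m) ?_ ?_).symm
      · simp [preComp, IndexedCat.pull₂_whiskerLeft]
      · simp [preComp, IndexedCat.pull₂_whiskerLeft])) (by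
    rintro _ _ ⟨m, l, r⟩
    funext q
    induction q using Quot.ind with | _ q =>
    refine (ofRep_eq (m ▷ q.rep) ?_ ?_).symm
    · simp [preComp, IndexedCat.pull₂_whiskerRight]
    · simp [preComp, IndexedCat.pull₂_whiskerRight])

lemma comp_ofRep {P Q S : Optic L R} (p : PreHom P Q) (q : PreHom Q S) :
    comp (ofRep p) (ofRep q) = ofRep (preComp p q) := rfl

instance category : Category (Optic L R) where
  Hom := Hom
  id P := ofRep (preId P)
  comp := comp
  id_comp {P Q} := by
    rintro ⟨p⟩
    refine ofRep_eq (p := preComp (preId P) p) (q := p) (λ_ p.rep).hom ?_ ?_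
    · simp [preComp, preId, IndexedCat.pull₂_leftUnitor]
    · simp [preComp, preId, IndexedCat.pull₂_leftUnitor]
  comp_id {P Q} := by
    rintro ⟨p⟩
    refine ofRep_eq (p := preComp p (preId Q)) (q := p) (ρ_ p.rep).hom ?_ ?_
    · simp [preComp, preId, IndexedCat.pull₂_rightUnitor, ← Functor.map_comp]
    · simp [preComp, preId, IndexedCat.pull₂_rightUnitor]
  assoc {P Q S T} := by
    rintro ⟨p⟩ ⟨q⟩ ⟨s⟩
    refine (ofRep_eq (p := preComp p (preComp q s)) (q := preComp (preComp p q) s)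
      (α_ p.rep q.rep s.rep).inv ?_ ?_).symm
    · have h : ∀ {Z} (k : _ ⟶ Z),
          (L.pull p.rep).map ((L.pullComp q.rep s.rep).inv.app T.fwd) ≫
            (L.pull p.rep).map ((L.pullComp q.rep s.rep).hom.app T.fwd) ≫ k = k := fun k => by
        rw [← Functor.map_comp_assoc, Iso.inv_hom_id_app, CategoryTheory.Functor.map_id,
          Category.id_comp]
      have hn := (L.pullComp p.rep q.rep).inv.naturality_assoc s.get
        ((L.pullComp (p.rep ≫ q.rep) s.rep).inv.app T.fwd)
      simp only [Functor.comp_map] at hn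
      simp [preComp, IndexedCat.pull₂_assoc_inv, h, hn]
    · simp [preComp, IndexedCat.pull₂_assoc_inv]

end Optic

/-- The category of dependent lenses. -/
abbrev DLens (C : Type u) [Category.{v} C] [HasPullbacks C] :=
  Optic (slicePseudofunctor C) (slicePseudofunctor C)

end Optics

end

end DependentOptics

/-! The coproduct of `(Xᵢ, X'ᵢ)` over `Aᵢ` is `(∐ Xᵢ, ∐ X'ᵢ)` over `∐ Aᵢ`. Extensivity splits a span
out of `∐ Aᵢ` into spans `Mᵢ` out of the `Aᵢ`, and the maps `l` and `r` split accordingly. The index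
category of the coend thus becomes a finite product, and the coend a finite product of coends; this
is the universal property. The proof works with representatives. In components, one is a span `M`,
maps `X ⟶ M` and `X ⟶ Y`, and a map `M ×_B Y' ⟶ X'`. A family of representatives is cotupled along
`∐ Mᵢ`: pullback preserves finite coproducts, so `(∐ Mᵢ) ×_D Y'` is the coproduct of the `Mᵢ ×_D Y'`
(`sigmaSliceIsColimit`) and the backward parts glue. The inclusions need a backward part `Aᵢ ×_{∐ A}
∐ X' ⟶ X'ᵢ`, which exists because `X'ᵢ` is that fibre product (`isPullback_bwdι`). Three facts then
give the colimit: cotupling respects classes (`ofRep_preDesc_congr`, where finiteness lets one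
coordinate change at a time), and the two triangle identities `ofRep_preIncl_preDesc` and
`ofRep_preDesc_preIncl`. Each identity of classes is witnessed by a map of spans, which need not be
shown invertible. -/

namespace DependentOptics

noncomputable section

/-! ### Fibre products along maps of apices -/

section sliceMap

variable {C : Type u} [Category.{v} C] [HasPullbacks C] {A B D : C}

/-- The map `M ×_D Y ⟶ N ×_D Y` induced by a map of apices over `D`. -/
def Spn.sliceMap {M : Spn A D} {N : Spn B D} (m : M.apex ⟶ N.apex) (h : m ≫ N.r = M.r)
    (Y : Over D) : ((slice M).obj Y).left ⟶ ((slice N).obj Y).left :=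
  sliceLift (toFib M Y) (toRep M Y ≫ m) (by simp [h])

@[simp]
lemma Spn.sliceMap_toFib {M : Spn A D} {N : Spn B D} (m : M.apex ⟶ N.apex) (h : m ≫ N.r = M.r)
    (Y : Over D) : sliceMap m h Y ≫ toFib N Y = toFib M Y := sliceLift_toFib _ _ _

@[simp]
lemma Spn.sliceMap_toRep {M : Spn A D} {N : Spn B D} (m : M.apex ⟶ N.apex) (h : m ≫ N.r = M.r)
    (Y : Over D) : sliceMap m h Y ≫ toRep N Y = toRep M Y ≫ m := sliceLift_toRep _ _ _

@[simp]
lemma Spn.sliceMap_toRep_assoc {M : Spn A D} {N : Spn B D} (m : M.apex ⟶ N.apex) (h : m ≫ N.r = M.r)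
    (Y : Over D) {Z : C} (k : _ ⟶ Z) :
    sliceMap m h Y ≫ toRep N Y ≫ k = toRep M Y ≫ m ≫ k := by
  rw [← Category.assoc, Spn.sliceMap_toRep, Category.assoc]

lemma Spn.isPullback_toFib_toRep (M : Spn A D) (Y : Over D) :
    IsPullback (toFib M Y) (toRep M Y) Y.hom M.r := IsPullback.of_hasPullback _ _

end sliceMap

/-- This is the part of a composite's backward map that precedes `r₁`, namely the inverse of `θ`
followed by `f^*(r₂)`. In components it keeps the coordinate in `S` and applies `k` to the remaining
coordinates. -/
lemma Spn.sliceComp_hom_app_comp_map_left {C : Type u} [Category.{v} C] [HasPullbacks C]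
    {A B D : C} (S : Spn A B) (T : Spn B D) {Y : Over D} {X : Over B} (k : (slice T).obj Y ⟶ X) :
    ((sliceComp S T).hom.app Y ≫ (slice S).map k).left =
      sliceLift (sliceMap (snd S T) (comp_r S T).symm Y ≫ k.left)
        (toRep (comp S T) Y ≫ fst S T) (by simp) := by
  apply slice_ext <;> simp [sliceMap]

/-! ### Representatives of lenses in components -/

namespace DLens

open Optic Spn

variable {C : Type u} [Category.{v} C]

section HasPullbacks

variable [HasPullbacks C]

/-- The object `(X, X')^A` of the category of dependent lenses. -/
def of {A : C} (X X' : Over A) : DLens C := ⟨⟨A⟩, X, X'⟩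

/-- The forward object of a dependent lens object. -/
def Fwd (P : DLens C) : Over P.base.obj := P.fwd

/-- The backward object of a dependent lens object. -/
def Bwd (P : DLens C) : Over P.base.obj := P.bwd

variable {P Q S : DLens C}

/-- The span underlying a representative. -/
def span (p : PreHom P Q) : Spn P.base.obj Q.base.obj := p.rep

/-- The forward part `X ⟶ M ×_B Y` of a representative. -/
def getHom (p : PreHom P Q) : Fwd P ⟶ (slice (span p)).obj (Fwd Q) := p.get

/-- The backward part `M ×_B Y' ⟶ X'` of a representative, over the base. -/
def putHom (p : PreHom P Q) : (slice (span p)).obj (Bwd Q) ⟶ Bwd P := p.put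

/-- The component `X ⟶ M` of the forward part `X ⟶ M ×_B Y` of a representative. -/
def getRep (p : PreHom P Q) : (Fwd P).left ⟶ (span p).apex :=
  (getHom p).left ≫ toRep _ _

/-- The component `X ⟶ Y` of the forward part `X ⟶ M ×_B Y` of a representative. -/
def getFib (p : PreHom P Q) : (Fwd P).left ⟶ (Fwd Q).left :=
  (getHom p).left ≫ toFib _ _

/-- The backward part `M ×_B Y' ⟶ X'` of a representative. -/
def put (p : PreHom P Q) : ((slice (span p)).obj (Bwd Q)).left ⟶ (Bwd P).left :=
  (putHom p).left

@[simp]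
lemma getRep_l (p : PreHom P Q) : getRep p ≫ (span p).l = (Fwd P).hom := by
  simpa [getRep] using Over.w (getHom p)

@[simp]
lemma getRep_l_assoc (p : PreHom P Q) {Z : C} (k : _ ⟶ Z) :
    getRep p ≫ (span p).l ≫ k = (Fwd P).hom ≫ k := by
  rw [← Category.assoc, getRep_l]

@[simp]
lemma getFib_hom (p : PreHom P Q) : getFib p ≫ (Fwd Q).hom = getRep p ≫ (span p).r := by
  simp [getFib, getRep]

@[simp]
lemma put_hom (p : PreHom P Q) : put p ≫ (Bwd P).hom = toRep (span p) (Bwd Q) ≫ (span p).l :=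
  Over.w (putHom p)

@[simp]
lemma put_hom_assoc (p : PreHom P Q) {Z : C} (k : _ ⟶ Z) :
    put p ≫ (Bwd P).hom ≫ k = toRep (span p) (Bwd Q) ≫ (span p).l ≫ k := by
  rw [← Category.assoc, put_hom, Category.assoc]

/-- A representative from its components. -/
def mk (M : Spn P.base.obj Q.base.obj) (a : (Fwd P).left ⟶ M.apex) (b : (Fwd P).left ⟶ (Fwd Q).left)
    (c : ((slice M).obj (Bwd Q)).left ⟶ (Bwd P).left) (ha : a ≫ M.l = (Fwd P).hom)
    (hb : b ≫ (Fwd Q).hom = a ≫ M.r) (hc : c ≫ (Bwd P).hom = toRep M (Bwd Q) ≫ M.l) :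
    PreHom P Q where
  rep := M
  get := (Over.homMk (sliceLift b a hb) (by simpa using ha) : Fwd P ⟶ (slice M).obj (Fwd Q))
  put := (Over.homMk c hc : (slice M).obj (Bwd Q) ⟶ Bwd P)

section mk

variable (M : Spn P.base.obj Q.base.obj) (a : (Fwd P).left ⟶ M.apex)
    (b : (Fwd P).left ⟶ (Fwd Q).left)
    (c : ((slice M).obj (Bwd Q)).left ⟶ (Bwd P).left) (ha : a ≫ M.l = (Fwd P).hom)
    (hb : b ≫ (Fwd Q).hom = a ≫ M.r) (hc : c ≫ (Bwd P).hom = toRep M (Bwd Q) ≫ M.l)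

lemma getRep_mk : getRep (mk M a b c ha hb hc) = a := sliceLift_toRep _ _ hb

lemma getFib_mk : getFib (mk M a b c ha hb hc) = b := sliceLift_toFib _ _ hb

end mk

section preComp

variable (p : PreHom P Q) (q : PreHom Q S)

/-- First projection from the apex `M ×_B N` of a composite. -/
def compFst : (span (preComp p q)).apex ⟶ (span p).apex := fst (span p) (span q)

/-- Second projection from the apex `M ×_B N` of a composite. -/
def compSnd : (span (preComp p q)).apex ⟶ (span q).apex := snd (span p) (span q)

@[simp]
lemma compSnd_l : compSnd p q ≫ (span q).l = compFst p q ≫ (span p).r := snd_l _ _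

lemma compFst_l : compFst p q ≫ (span p).l = (span (preComp p q)).l := rfl

lemma compFst_l_assoc {Z : C} (k : _ ⟶ Z) :
    compFst p q ≫ (span p).l ≫ k = (span (preComp p q)).l ≫ k := by
  rw [← Category.assoc, compFst_l]

lemma compSnd_r : compSnd p q ≫ (span q).r = (span (preComp p q)).r := rfl

variable {p q}

/-- The map into the apex `M ×_B N` of a composite with given components. -/
def compLift {W : C} (a : W ⟶ (span p).apex) (b : W ⟶ (span q).apex)
    (h : a ≫ (span p).r = b ≫ (span q).l) : W ⟶ (span (preComp p q)).apex := lift a b h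

@[simp]
lemma compLift_fst {W : C} (a : W ⟶ (span p).apex) (b : W ⟶ (span q).apex)
    (h : a ≫ (span p).r = b ≫ (span q).l) : compLift a b h ≫ compFst p q = a := lift_fst _ _ h

@[simp]
lemma compLift_fst_assoc {W : C} (a : W ⟶ (span p).apex) (b : W ⟶ (span q).apex)
    (h : a ≫ (span p).r = b ≫ (span q).l) {Z : C} (k : _ ⟶ Z) :
    compLift a b h ≫ compFst p q ≫ k = a ≫ k := by
  rw [← Category.assoc, compLift_fst]

@[simp]
lemma compLift_snd {W : C} (a : W ⟶ (span p).apex) (b : W ⟶ (span q).apex)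
    (h : a ≫ (span p).r = b ≫ (span q).l) : compLift a b h ≫ compSnd p q = b := lift_snd _ _ h

@[simp]
lemma compLift_snd_assoc {W : C} (a : W ⟶ (span p).apex) (b : W ⟶ (span q).apex)
    (h : a ≫ (span p).r = b ≫ (span q).l) {Z : C} (k : _ ⟶ Z) :
    compLift a b h ≫ compSnd p q ≫ k = b ≫ k := by
  rw [← Category.assoc, compLift_snd]

lemma preComp_apex_ext {W : C} {f g : W ⟶ (span (preComp p q)).apex}
    (h₁ : f ≫ compFst p q = g ≫ compFst p q) (h₂ : f ≫ compSnd p q = g ≫ compSnd p q) : f = g :=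
  comp_ext h₁ h₂

end preComp

lemma getFib_preComp (p : PreHom P Q) (q : PreHom Q S) :
    getFib (preComp p q) = getFib p ≫ getFib q := by
  change (getHom p ≫ (slice (span p)).map (getHom q) ≫ (sliceComp (span p) (span q)).inv.app (Fwd S)).left ≫
    toFib _ _ = ((getHom p).left ≫ toFib _ _) ≫ (getHom q).left ≫ toFib _ _
  simp

@[simp]
lemma getRep_preComp_fst (p : PreHom P Q) (q : PreHom Q S) :
    getRep (preComp p q) ≫ compFst p q = getRep p := by
  change ((getHom p ≫ (slice (span p)).map (getHom q) ≫ (sliceComp (span p) (span q)).inv.app (Fwd S)).left ≫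
    toRep _ _) ≫ fst _ _ = (getHom p).left ≫ toRep _ _
  simp

@[simp]
lemma getRep_preComp_snd (p : PreHom P Q) (q : PreHom Q S) :
    getRep (preComp p q) ≫ compSnd p q = getFib p ≫ getRep q := by
  change ((getHom p ≫ (slice (span p)).map (getHom q) ≫ (sliceComp (span p) (span q)).inv.app (Fwd S)).left ≫
    toRep _ _) ≫ snd _ _ = ((getHom p).left ≫ toFib _ _) ≫ (getHom q).left ≫ toRep _ _
  simp

/-- The backward parts compose as `M ×_B (N ×_D Z') ⟶ M ×_B Y' ⟶ X'`, the coordinate in `M` being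
carried along until `put p` consumes it. -/
lemma put_preComp (p : PreHom P Q) (q : PreHom Q S) :
    put (preComp p q) = sliceLift (sliceMap (compSnd p q) (compSnd_r p q) (Bwd S) ≫ put q)
      (toRep (span (preComp p q)) (Bwd S) ≫ compFst p q) (by simp) ≫ put p := by
  exact (Category.assoc _ _ _).symm.trans (congrArg (· ≫ (putHom p).left)
    (sliceComp_hom_app_comp_map_left (span p) (span q) (putHom q)))

/-- Two representatives are equal as lenses if they are related by a map of apices. -/
lemma ofRep_eq_of_map {p q : PreHom P Q} (m : (span p).apex ⟶ (span q).apex)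
    (hl : m ≫ (span q).l = (span p).l) (hr : m ≫ (span q).r = (span p).r)
    (h₁ : getFib p = getFib q) (h₂ : getRep p ≫ m = getRep q)
    (h₃ : put p = sliceMap m hr (Bwd Q) ≫ put q) : ofRep p = ofRep q := by
  refine ofRep_eq (Span.Hom.mk m hl hr : span p ⟶ span q) ?_ ?_
  -- A map into the fibre product is determined by its two projections, and these are what `h₁` and
  -- `h₂` control.
  · refine Over.OverMorphism.ext (slice_ext (S := span q) (Y := Fwd Q) ?_ ?_)
    · let g := show Fwd P ⟶ (slice (span p)).obj (Fwd Q) from p.get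
      change (getHom p ≫ (slice₂ (Span.Hom.mk m hl hr)).app (Fwd Q)).left ≫ toFib _ _ = getFib q
      rw [← h₁]
      simp [getFib]
    · let g := show Fwd P ⟶ (slice (span p)).obj (Fwd Q) from p.get
      change (getHom p ≫ (slice₂ (Span.Hom.mk m hl hr)).app (Fwd Q)).left ≫ toRep _ _ = getRep q
      rw [← h₂]
      simp [getRep]
  · exact Over.OverMorphism.ext h₃

/-- The relation between representatives, on underlying maps of apices. -/
lemma rel_exists {p q : PreHom P Q} (h : Rel P Q q p) :
    ∃ (m : (span p).apex ⟶ (span q).apex) (_ : m ≫ (span q).l = (span p).l)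
      (hr : m ≫ (span q).r = (span p).r), getFib p = getFib q ∧ getRep p ≫ m = getRep q ∧
      put p = sliceMap m hr (Bwd Q) ≫ put q := by
  -- `Rel` lists the target of the 2-cell before its source, hence the order `Rel P Q q p` for a map
  -- from the apex of `p` to that of `q`.
  obtain @⟨f, g, m, l, r⟩ := h
  let m' : (show Spn _ _ from f) ⟶ (show Spn _ _ from g) := m
  let l' := show Fwd P ⟶ (slice (show Spn _ _ from f)).obj (Fwd Q) from l
  refine ⟨m'.hom, m'.hom_l, m'.hom_r, ?_, ?_, rfl⟩
  · change l'.left ≫ toFib _ _ = (l' ≫ (slice₂ m').app (Fwd Q)).left ≫ toFib _ _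
    simp
  · change (l'.left ≫ toRep _ _) ≫ _ = (l' ≫ (slice₂ m').app (Fwd Q)).left ≫ toRep _ _
    simp

end HasPullbacks

end DLens

end

end DependentOptics

/-! ### Functions on finite families of quotients -/

/-- This lets cotupling descend to classes. The equality alternative in `hf` makes up for `r i` not
being reflexive: a step in one coordinate can be taken while all others stay fixed. -/
lemma Quot.apply_eq_of_forall_mk_eq {ι : Type*} [Finite ι] {α : ι → Type*}
    {r : ∀ i, α i → α i → Prop} {β : Sort*} (f : (∀ i, α i) → β)
    (hf : ∀ p q : ∀ i, α i, (∀ i, p i = q i ∨ r i (p i) (q i)) → f p = f q)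
    {p q : ∀ i, α i} (h : ∀ i, Quot.mk (r i) (p i) = Quot.mk (r i) (q i)) : f p = f q := by
  classical
  have := Fintype.ofFinite ι
  -- A zigzag of steps in coordinate `i` alone leaves `f` unchanged, since `hf` applies to each
  -- step.
  have key (i : ι) (a b : α i) (hab : Relation.EqvGen (r i) a b) (s : ∀ i, α i) :
      f (Function.update s i a) = f (Function.update s i b) := by
    induction hab with
    | rel a b hab =>
      refine hf _ _ fun j => ?_
      by_cases hj : j = i
      · subst hj; simpa using Or.inr hab
      · simp [hj]
    | refl => rfl
    | symm _ _ _ ih => exact ih.symm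
    | trans _ _ _ _ _ ih₁ ih₂ => exact ih₁.trans ih₂
  -- The coordinates are replaced one at a time; finiteness of `ι` is what lets this reach all of
  -- them.
  have hs (s : Finset ι) : f (fun i => if i ∈ s then q i else p i) = f p := by
    induction s using Finset.induction_on with
    | empty => simp
    | insert i s hi ih =>
      rw [← ih]
      convert key i (q i) (p i) (Quot.eqvGen_exact (h i).symm)
        (fun j => if j ∈ s then q j else p j) using 2
      · ext j
        by_cases hj : j = i
        · subst hj; simp
        · simp [hj]
      · ext j
        by_cases hj : j = i
        · subst hj; simp [hi]
        · simp [hj]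
  simpa using (hs Finset.univ).symm

/-! ### Finite coproducts and pullbacks in an extensive category -/

namespace CategoryTheory.FinitaryExtensive

variable {C : Type u} [Category.{v} C] [FinitaryExtensive C] {ι : Type*} [Finite ι]

/-- Coproduct cocones are van Kampen; this is the direction from "the top cocone is a coproduct" to
"the squares are pullbacks". -/
lemma isPullback_sigma_map {X Y : ι → C} (f : ∀ i, X i ⟶ Y i) (i : ι) :
    IsPullback (Sigma.ι X i) (f i) (Limits.Sigma.map f) (Sigma.ι Y i) :=
  ((isVanKampen_finiteCoproducts (coproductIsCoproduct Y)) (Cofan.mk _ (Sigma.ι X))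
    (Discrete.natTrans fun i => f i.as) (Limits.Sigma.map f) (by ext; simp)
    (NatTrans.Equifibered.of_discrete _)).1 ⟨coproductIsCoproduct X⟩ ⟨i⟩

/-- The pullback of a finite coproduct cofan is a coproduct cofan. -/
lemma nonempty_isColimit_of_isPullback {Y : ι → C} {Z : C} (f : Z ⟶ ∐ Y) {X : ι → C}
    (a : ∀ i, X i ⟶ Z) (b : ∀ i, X i ⟶ Y i) (h : ∀ i, IsPullback (a i) (b i) f (Sigma.ι Y i)) :
    Nonempty (IsColimit (Cofan.mk Z a)) :=
  (FinitaryPreExtensive.isUniversal_finiteCoproducts (coproductIsCoproduct Y)) (Cofan.mk Z a)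
    (Discrete.natTrans fun i => b i.as) f (by ext i; simpa using (h i.as).w.symm)
    (NatTrans.Equifibered.of_discrete _) (fun i => h i.as)

end CategoryTheory.FinitaryExtensive

/-! ### The coproduct object and its inclusions -/

namespace DependentOptics

noncomputable section

namespace DLens

open Optic Spn

variable {C : Type u} [Category.{v} C] [HasPullbacks C] [FinitaryExtensive C]
  {ι : Type*} [Finite ι]

variable (P : ι → DLens C)

/-- The coproduct `(∐ Xᵢ, ∐ X'ᵢ)` over `∐ Aᵢ` of a family of objects `(Xᵢ, X'ᵢ)` over `Aᵢ`. -/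
def sigma : DLens C :=
  of (A := ∐ fun i => (P i).base.obj) (Over.mk (Limits.Sigma.map fun i => (Fwd (P i)).hom))
    (Over.mk (Limits.Sigma.map fun i => (Bwd (P i)).hom))

/-- The inclusion `Xᵢ ⟶ ∐ Xᵢ` of forward objects. -/
def fwdι (i : ι) : (Fwd (P i)).left ⟶ (Fwd (sigma P)).left := Sigma.ι (fun i => (Fwd (P i)).left) i

/-- The inclusion `X'ᵢ ⟶ ∐ X'ᵢ` of backward objects. -/
def bwdι (i : ι) : (Bwd (P i)).left ⟶ (Bwd (sigma P)).left := Sigma.ι (fun i => (Bwd (P i)).left) i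

/-- The inclusion `Aᵢ ⟶ ∐ Aᵢ` of base objects. -/
def baseι (i : ι) : (P i).base.obj ⟶ (sigma P).base.obj := Sigma.ι (fun i => (P i).base.obj) i

@[simp]
lemma fwdι_hom (i : ι) : fwdι P i ≫ (Fwd (sigma P)).hom = (Fwd (P i)).hom ≫ baseι P i :=
  Limits.Sigma.ι_map (fun i => (Fwd (P i)).hom) i

@[simp]
lemma bwdι_hom (i : ι) : bwdι P i ≫ (Bwd (sigma P)).hom = (Bwd (P i)).hom ≫ baseι P i :=
  Limits.Sigma.ι_map (fun i => (Bwd (P i)).hom) i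

/-- The fibre of `∐ X'ᵢ` over the summand `Aᵢ` is `X'ᵢ`, which supplies the backward part of the
inclusion. -/
lemma isPullback_bwdι (i : ι) :
    IsPullback (bwdι P i) (Bwd (P i)).hom (Bwd (sigma P)).hom (baseι P i) :=
  FinitaryExtensive.isPullback_sigma_map (fun i => (Bwd (P i)).hom) i

/-- Maps into `X'ᵢ` can therefore be compared inside `∐ X'ᵢ`, where `put_preIncl` describes the
inclusion's backward part as a mere projection. -/
instance (i : ι) : Mono (bwdι P i) :=
  inferInstanceAs (Mono (Sigma.ι (fun i => (Bwd (P i)).left) i))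

variable {P}

lemma fwd_ext {W : C} {f g : (Fwd (sigma P)).left ⟶ W}
    (h : ∀ i, fwdι P i ≫ f = fwdι P i ≫ g) : f = g :=
  Limits.Sigma.hom_ext _ _ h

/-- The map out of `∐ Xᵢ` with given components. -/
def fwdDesc {W : C} (f : ∀ i, (Fwd (P i)).left ⟶ W) : (Fwd (sigma P)).left ⟶ W := Sigma.desc f

@[simp]
lemma fwdι_desc {W : C} (f : ∀ i, (Fwd (P i)).left ⟶ W) (i : ι) :
    fwdι P i ≫ fwdDesc f = f i := Limits.Sigma.ι_desc _ _

@[simp]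
lemma fwdι_desc_assoc {W : C} (f : ∀ i, (Fwd (P i)).left ⟶ W) (i : ι)
    {Z : C} (k : _ ⟶ Z) :
    fwdι P i ≫ fwdDesc f ≫ k = f i ≫ k := by
  rw [← Category.assoc, fwdι_desc]

variable (P)

/-- The span `Aᵢ = Aᵢ ⟶ ∐ Aᵢ`. -/
def inclSpan (i : ι) : Spn (P i).base.obj (sigma P).base.obj where
  apex := (P i).base.obj
  l := 𝟙 _
  r := baseι P i
  wl := trivial
  wr := trivial

/-- The backward part `Aᵢ ×_{∐ Aᵢ} (∐ X'ᵢ) ⟶ X'ᵢ` of the coproduct inclusion. -/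
def inclPut (i : ι) : ((slice (inclSpan P i)).obj (Bwd (sigma P))).left ⟶ (Bwd (P i)).left :=
  (isPullback_bwdι P i).lift (toFib _ _) (toRep (inclSpan P i) _) (toFib_hom (inclSpan P i) _)

@[simp]
lemma inclPut_bwdι (i : ι) : inclPut P i ≫ bwdι P i = toFib _ _ := IsPullback.lift_fst _ _ _ _

@[simp]
lemma inclPut_hom (i : ι) : inclPut P i ≫ (Bwd (P i)).hom = toRep (inclSpan P i) _ :=
  IsPullback.lift_snd _ _ _ _

/-- The representative of the coproduct inclusion `(Xᵢ, X'ᵢ) ⟶ (∐ Xᵢ, ∐ X'ᵢ)`. -/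
def preIncl (i : ι) : PreHom (P i) (sigma P) :=
  mk (inclSpan P i) (Fwd (P i)).hom (fwdι P i) (inclPut P i) (Category.comp_id _) (fwdι_hom P i)
    ((inclPut_hom P i).trans (Category.comp_id _).symm)

/-- The map from `Aᵢ` to the apex of the coproduct inclusion. -/
def toIncl (i : ι) : (P i).base.obj ⟶ (span (preIncl P i)).apex := 𝟙 _

@[simp]
lemma toIncl_l (i : ι) : toIncl P i ≫ (span (preIncl P i)).l = 𝟙 _ := Category.comp_id _

@[simp]
lemma toIncl_r (i : ι) : toIncl P i ≫ (span (preIncl P i)).r = baseι P i := Category.id_comp _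

lemma preIncl_r (i : ι) : (span (preIncl P i)).r = (span (preIncl P i)).l ≫ baseι P i :=
  (Category.id_comp _).symm

instance (i : ι) : Mono (span (preIncl P i)).l := inferInstanceAs (Mono (𝟙 _))

@[simp]
lemma getFib_preIncl (i : ι) : getFib (preIncl P i) = fwdι P i := getFib_mk ..

@[simp]
lemma put_preIncl (i : ι) : put (preIncl P i) ≫ bwdι P i = toFib _ _ := inclPut_bwdι P i


/-! ### Cotupling of lenses and the universal property -/

variable {P} {Q : DLens C} {D : C}

/-- The span `∐ Aᵢ ⟵ ∐ Mᵢ ⟶ D` induced by a family of spans `Aᵢ ⟵ Mᵢ ⟶ D`. -/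
def sigmaSpan (M : ∀ i, Spn (P i).base.obj D) : Spn (sigma P).base.obj D where
  apex := ∐ fun i => (M i).apex
  l := Limits.Sigma.map fun i => (M i).l
  r := Sigma.desc fun i => (M i).r
  wl := trivial
  wr := trivial

section sigmaSpan

variable (M : ∀ i, Spn (P i).base.obj D) (Y : Over D)

/-- The inclusion of an apex into the apex of `sigmaSpan`. -/
def sigmaSpanι (i : ι) : (M i).apex ⟶ (sigmaSpan M).apex := Sigma.ι (fun i => (M i).apex) i

@[simp]
lemma sigmaSpanι_l (i : ι) : sigmaSpanι M i ≫ (sigmaSpan M).l = (M i).l ≫ baseι P i :=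
  Limits.Sigma.ι_map (fun i => (M i).l) i

@[simp]
lemma sigmaSpanι_r (i : ι) : sigmaSpanι M i ≫ (sigmaSpan M).r = (M i).r :=
  Limits.Sigma.ι_desc _ _

/-- The inclusion `Mᵢ ×_D Y ⟶ (∐ Mᵢ) ×_D Y`. -/
def sigmaSliceι (i : ι) : ((slice (M i)).obj Y).left ⟶ ((slice (sigmaSpan M)).obj Y).left :=
  sliceMap (sigmaSpanι M i) (sigmaSpanι_r M i) Y

lemma isPullback_sigmaSliceι (i : ι) :
    IsPullback (sigmaSliceι M Y i) (toRep (M i) Y) (toRep (sigmaSpan M) Y) (sigmaSpanι M i) := by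
  -- Pasting with the fibre product `(∐ Mᵢ) ×_D Y` over `D`: the outer rectangle is the fibre
  -- product `Mᵢ ×_D Y`, so the remaining square is a pullback.
  refine IsPullback.of_right ?_ (sliceMap_toRep _ _ _) (isPullback_toFib_toRep _ _)
  simpa [sigmaSliceι] using isPullback_toFib_toRep (M i) Y

/-- `(∐ Mᵢ) ×_D Y` is the coproduct of the `Mᵢ ×_D Y`. -/
def sigmaSliceIsColimit :
    IsColimit (Cofan.mk ((slice (sigmaSpan M)).obj Y).left (sigmaSliceι M Y)) :=
  -- Stability of the coproduct `∐ Mᵢ` under pullback along the projection to it.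
  (FinitaryExtensive.nonempty_isColimit_of_isPullback (toRep (sigmaSpan M) Y) _ _
    (isPullback_sigmaSliceι M Y)).some

variable {M Y}

lemma sigmaSlice_ext {W : C} {f g : ((slice (sigmaSpan M)).obj Y).left ⟶ W}
    (h : ∀ i, sigmaSliceι M Y i ≫ f = sigmaSliceι M Y i ≫ g) : f = g :=
  Cofan.IsColimit.hom_ext (sigmaSliceIsColimit M Y) _ _ h

/-- The map out of `(∐ Mᵢ) ×_D Y` with given components. -/
def sigmaSliceDesc {W : C} (f : ∀ i, ((slice (M i)).obj Y).left ⟶ W) :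
    ((slice (sigmaSpan M)).obj Y).left ⟶ W :=
  Cofan.IsColimit.desc (sigmaSliceIsColimit M Y) f

@[simp]
lemma sigmaSliceι_desc {W : C} (f : ∀ i, ((slice (M i)).obj Y).left ⟶ W) (i : ι) :
    sigmaSliceι M Y i ≫ sigmaSliceDesc f = f i :=
  Cofan.IsColimit.fac (sigmaSliceIsColimit M Y) f i

@[simp]
lemma sigmaSliceι_desc_assoc {W : C} (f : ∀ i, ((slice (M i)).obj Y).left ⟶ W) (i : ι)
    {Z : C} (k : _ ⟶ Z) :
    sigmaSliceι M Y i ≫ sigmaSliceDesc f ≫ k = f i ≫ k := by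
  rw [← Category.assoc, sigmaSliceι_desc]

end sigmaSpan

/-- The representative of the lens out of a coproduct with given components. -/
def preDesc (p : ∀ i, PreHom (P i) Q) : PreHom (sigma P) Q :=
  mk (sigmaSpan fun i => span (p i))
    (fwdDesc fun i => getRep (p i) ≫ sigmaSpanι (fun i => span (p i)) i)
    (fwdDesc fun i => getFib (p i)) (sigmaSliceDesc fun i => put (p i) ≫ bwdι P i)
    (fwd_ext fun i => by simp) (fwd_ext fun i => by simp) (sigmaSlice_ext fun i => by
      rw [sigmaSliceι_desc_assoc]; simp [sigmaSliceι])

section preDesc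

variable (p : ∀ i, PreHom (P i) Q)

/-- The inclusion `Mᵢ ⟶ ∐ Mᵢ`. -/
def descι (i : ι) : (span (p i)).apex ⟶ (span (preDesc p)).apex :=
  sigmaSpanι (fun i => span (p i)) i

@[simp]
lemma descι_l (i : ι) : descι p i ≫ (span (preDesc p)).l = (span (p i)).l ≫ baseι P i :=
  sigmaSpanι_l _ i

@[simp]
lemma descι_r (i : ι) : descι p i ≫ (span (preDesc p)).r = (span (p i)).r :=
  sigmaSpanι_r _ i

variable {p} in
lemma desc_ext {W : C} {f g : (span (preDesc p)).apex ⟶ W}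
    (h : ∀ i, descι p i ≫ f = descι p i ≫ g) : f = g :=
  Limits.Sigma.hom_ext _ _ h

variable {p} in
/-- The map out of `∐ Mᵢ` with given components. -/
def descDesc {W : C} (f : ∀ i, (span (p i)).apex ⟶ W) : (span (preDesc p)).apex ⟶ W :=
  Sigma.desc f

variable {p} in
@[simp]
lemma descι_desc {W : C} (f : ∀ i, (span (p i)).apex ⟶ W) (i : ι) :
    descι p i ≫ descDesc f = f i := Limits.Sigma.ι_desc _ _

variable {p} in
@[simp]
lemma descι_desc_assoc {W : C} (f : ∀ i, (span (p i)).apex ⟶ W) (i : ι)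
    {Z : C} (k : _ ⟶ Z) :
    descι p i ≫ descDesc f ≫ k = f i ≫ k := by
  rw [← Category.assoc, descι_desc]

variable {p} in
lemma descSlice_ext {W : C} {f g : ((slice (span (preDesc p))).obj (Bwd Q)).left ⟶ W}
    (h : ∀ i, sliceMap (descι p i) (descι_r p i) (Bwd Q) ≫ f =
      sliceMap (descι p i) (descι_r p i) (Bwd Q) ≫ g) : f = g :=
  sigmaSlice_ext h

@[simp]
lemma getRep_preDesc (i : ι) : fwdι P i ≫ getRep (preDesc p) = getRep (p i) ≫ descι p i :=
  (congrArg (fwdι P i ≫ ·) (getRep_mk ..)).trans (fwdι_desc _ i)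

@[simp]
lemma getRep_preDesc_assoc (i : ι)
    {Z : C} (k : _ ⟶ Z) :
    fwdι P i ≫ getRep (preDesc p) ≫ k = getRep (p i) ≫ descι p i ≫ k := by
  rw [← Category.assoc, getRep_preDesc, Category.assoc]

@[simp]
lemma getFib_preDesc (i : ι) : fwdι P i ≫ getFib (preDesc p) = getFib (p i) := by
  rw [preDesc, getFib_mk, fwdι_desc]

@[simp]
lemma put_preDesc (i : ι) : sliceMap (descι p i) (descι_r p i) (Bwd Q) ≫ put (preDesc p) =
    put (p i) ≫ bwdι P i :=
  sigmaSliceι_desc (M := fun i => span (p i)) _ i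

end preDesc

/-- Maps of spans `Mᵢ ⟶ Nᵢ` assemble to a map `∐ Mᵢ ⟶ ∐ Nᵢ`, so simultaneous generating relations
are sent to a single one. -/
lemma ofRep_preDesc_congr {p q : ∀ i, PreHom (P i) Q} (h : ∀ i, ofRep (p i) = ofRep (q i)) :
    ofRep (preDesc p) = ofRep (preDesc q) := by
  refine Quot.apply_eq_of_forall_mk_eq (fun p => ofRep (preDesc p)) ?_ h
  -- The names are swapped because the generating relation puts the target of the 2-cell first; the
  -- maps `m i` go from `p i` to `q i`.
  intro q p h
  have h' (i : ι) : ∃ (m : (span (p i)).apex ⟶ (span (q i)).apex)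
      (_ : m ≫ (span (q i)).l = (span (p i)).l) (hr : m ≫ (span (q i)).r = (span (p i)).r),
      getFib (p i) = getFib (q i) ∧ getRep (p i) ≫ m = getRep (q i) ∧
      put (p i) = sliceMap m hr (Bwd Q) ≫ put (q i) := by
    obtain h | h := h i
    · rw [h]
      refine ⟨𝟙 _, Category.id_comp _, Category.id_comp _, rfl, Category.comp_id _, ?_⟩
      conv_lhs => rw [← Category.id_comp (put (p i))]
      congr 1
      apply slice_ext <;> simp
    · exact rel_exists h
  choose m hl hr h₁ h₂ h₃ using h'
  let n : (span (preDesc p)).apex ⟶ (span (preDesc q)).apex := descDesc fun i => m i ≫ descι q i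
  have hn (i : ι) : descι p i ≫ n = m i ≫ descι q i := descι_desc _ i
  have hnr : n ≫ (span (preDesc q)).r = (span (preDesc p)).r :=
    desc_ext fun i => by simp [reassoc_of% hn, hr]
  refine (ofRep_eq_of_map n (desc_ext fun i => ?_) hnr (fwd_ext fun i => ?_)
    (fwd_ext fun i => ?_) (descSlice_ext fun i => ?_)).symm
  · simp [reassoc_of% hn, reassoc_of% hl]
  · simp [h₁]
  · simp [hn, reassoc_of% h₂]
  · rw [put_preDesc, h₃, Category.assoc, ← put_preDesc, ← Category.assoc, ← Category.assoc]
    congr 1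
    apply slice_ext <;> simp [hn]

/-- Restricting `∐ Mⱼ` to the summand `Aᵢ` gives back `Mᵢ`; the comparison map `Mᵢ ⟶ Aᵢ ×_{∐ A} ∐
Mⱼ` pairs the left leg with the inclusion. -/
lemma ofRep_preIncl_preDesc (p : ∀ i, PreHom (P i) Q) (i : ι) :
    ofRep (preComp (preIncl P i) (preDesc p)) = ofRep (p i) := by
  let n : (span (p i)).apex ⟶ (span (preComp (preIncl P i) (preDesc p))).apex :=
    compLift ((span (p i)).l ≫ toIncl P i) (descι p i) (by simp)
  have hnr : n ≫ (span (preComp (preIncl P i) (preDesc p))).r = (span (p i)).r := by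
    simp [n, ← compSnd_r]
  refine (ofRep_eq_of_map n ?_ hnr ?_ (preComp_apex_ext ?_ ?_) ?_).symm
  · simp [n, ← compFst_l]
  · simp [getFib_preComp]
  · simp [n, ← cancel_mono (span (preIncl P i)).l]
  · simp [n]
  -- After embedding `X'ᵢ` in `∐ X'`, the inclusion's backward part disappears and both sides
  -- restrict `put (preDesc p)` to the summand `Mᵢ ×_D Y'`.
  · rw [← cancel_mono (bwdι P i), put_preComp]
    simp only [Category.assoc, put_preIncl, sliceLift_toFib]
    rw [← put_preDesc, ← Category.assoc]
    congr 1
    apply slice_ext <;> simp [n]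

/-- A span `M` out of `∐ Aᵢ` is recovered from its restrictions `Aᵢ ×_{∐ A} M`; the comparison map
out of their coproduct is given by the projections to `M`. -/
lemma ofRep_preDesc_preIncl (s : PreHom (sigma P) Q) :
    ofRep (preDesc fun i => preComp (preIncl P i) s) = ofRep s := by
  let n : (span (preDesc fun i => preComp (preIncl P i) s)).apex ⟶ (span s).apex :=
    descDesc fun i => compSnd (preIncl P i) s
  have hnr : n ≫ (span s).r = (span (preDesc fun i => preComp (preIncl P i) s)).r :=
    desc_ext fun i => by simp [n, compSnd_r]
  refine ofRep_eq_of_map n (desc_ext fun i => ?_) hnr (fwd_ext fun i => ?_)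
    (fwd_ext fun i => ?_) (descSlice_ext fun i => ?_)
  · simp [n, preIncl_r, compFst_l_assoc]
  · simp [getFib_preComp]
  · simp [n]
  · rw [put_preDesc, put_preComp]
    simp only [Category.assoc, put_preIncl, sliceLift_toFib]
    rw [← Category.assoc]
    congr 1
    apply slice_ext <;> simp [n]

variable (P) in
/-- The cofan of coproduct inclusions of dependent lenses. -/
def sigmaCofan : Cofan P := Cofan.mk (sigma P) fun i => ofRep (preIncl P i)

variable (P) in
/-- `sigma P` is a coproduct. -/
def sigmaCofanIsColimit : IsColimit (sigmaCofan P) :=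
  -- Representatives are chosen arbitrarily; existence holds for any choice, and only uniqueness
  -- needs independence of it.
  Cofan.IsColimit.mk _ (fun c => ofRep (preDesc fun i => Quot.out (c.inj i)))
    (fun c i => (ofRep_preIncl_preDesc _ i).trans (Quot.out_eq _))
    (fun c m h => by
      obtain ⟨s⟩ := m
      -- The lens `s` is the cotuple of its restrictions, and these have the same classes as the
      -- chosen representatives.
      refine (ofRep_preDesc_preIncl s).symm.trans (ofRep_preDesc_congr fun i => ?_)
      exact (h i).trans (Quot.out_eq _).symm)

end DLens

end

end DependentOptics

theorem mainTheorem5 (C : Type u) [Category.{v} C] [HasFiniteLimits C] [FinitaryExtensive C] :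
    HasFiniteCoproducts (DependentOptics.DLens C) where
  out _ := ⟨fun F =>
    -- A diagram on a discrete category is isomorphic to the one given by its family of objects; the
    -- empty family yields the initial object.
    have : HasColimit (Discrete.functor (F.obj ∘ Discrete.mk)) := ⟨_, DependentOptics.DLens.sigmaCofanIsColimit _⟩
    hasColimit_of_iso Discrete.natIsoFunctor⟩
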